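/- **Proposition (Luthar–Passi).** Let $G$ be a finite group, let $n$ be a positive integer, let $u$ be a unit of the integral group ring $\mathbb{Z}G$ with $u^n=1$, let $\zeta_n\in\mathbb{C}$ be a primitive $n$-th root of unity, let $\rho$ be a finite-dimensional complex representation of $G$ with character $\chi$, and let $i\in\mathbb{Z}$. For a conjugacy class $C$ of $G$ write $\chi(C)=\chi(g)$ for any $g\in C$, and for $a=\sum_{g\in G}a_g g\in\mathbb{Z}G$ let $\varepsilon_C(a)=\sum_{g\in C}a_g$ be the partial augmentation of $a$ at $C$. For a positive integer $m$ let $\mathrm{Cl}_m(G)$ denote the set of conjugacy classes of $G$ whose elements have order dividing $m$. For $d\mid n$ and $C\in \mathrm{Cl}_{n/d}(G)$ the number $\chi(C)\zeta_n^{-id}$ lies in $\mathbb{Q}(\zeta_n^d)$, and $$\frac1n\sum_{d\mid n}\ \sum_{C\in \mathrm{Cl}_{n/d}(G)}\varepsilon_C(u^d)\,\mathrm{Tr}_{\mathbb{Q}(\zeta_n^d)/\mathbb{Q}}\bigl(\chi(C)\zeta_n^{-id}\bigr)$$ is a nonnegative integer. More precisely, it equals the multiplicity of $\zeta_n^i$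 as an eigenvalue of $\rho(u)$ (algebraic or geometric, the two being equal), where $\rho$ is extended additively to $\mathbb{Z}G$ by $\rho\bigl(\sum_g a_g g\bigr)=\sum_g a_g\rho(g)$. -/

import Mathlib

noncomputable section

namespace GroupRingUnits

variable {G : Type*} [Group G]

/-- The order of a conjugacy class: the order of any of its elements. -/
def classOrder (C : ConjClasses G) : ℕ :=
  Quotient.lift (s := IsConj.setoid G) (fun g : G => orderOf g) (by
    intro a b hab
    obtain ⟨c, rfl⟩ := isConj_iff.1 hab
    have h : c * a * c⁻¹ = MulAut.conj c a := rfl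
    show orderOf a = orderOf (c * a * c⁻¹)
    rw [h]
    exact (MulEquiv.orderOf_eq (MulAut.conj c) a).symm) C

@[simp]
theorem classOrder_mk (g : G) : classOrder (ConjClasses.mk g) = orderOf g := rfl

/-- `Cl G m` is the (finite) set of conjugacy classes of `G` whose order divides `m`. -/
def Cl (G : Type*) [Group G] [Finite G] (m : ℕ) : Finset (ConjClasses G) :=
  (Set.toFinite {C : ConjClasses G | classOrder C ∣ m}).toFinset

@[simp]
theorem mem_Cl [Finite G] {m : ℕ} {C : ConjClasses G} : C ∈ Cl G m ↔ classOrder C ∣ m := by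
  simp [Cl]

open scoped Classical in
/-- The partial augmentation of `a = ∑ a_g g` in `ℤG` at the conjugacy class `C`:
the sum of the coefficients `a_g` over `g ∈ C`. -/
def partialAug (C : ConjClasses G) (a : MonoidAlgebra ℤ G) : ℤ :=
  ∑ g ∈ a.coeff.support with g ∈ C.carrier, a.coeff g

variable {V : Type*} [AddCommGroup V] [Module ℂ V]

/-- The value `χ(C)` at a conjugacy class of the character `χ` afforded by `ρ`. -/
def classChar (ρ : Representation ℂ G V) (C : ConjClasses G) : ℂ :=
  Quotient.lift (s := IsConj.setoid G) ρ.character (by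
    intro a b hab
    obtain ⟨c, rfl⟩ := isConj_iff.1 hab
    exact (ρ.char_conj a c).symm) C

@[simp]
theorem classChar_mk (ρ : Representation ℂ G V) (g : G) :
    classChar ρ (ConjClasses.mk g) = ρ.character g := rfl

/-- The extension of a representation of `G` to the group ring `ℤG`,
`∑ a_g g ↦ ∑ a_g ρ(g)`. -/
def extend (ρ : Representation ℂ G V) : MonoidAlgebra ℤ G →+* Module.End ℂ V :=
  (MonoidAlgebra.lift ℤ (Module.End ℂ V) G ρ : MonoidAlgebra ℤ G →+* Module.End ℂ V)

/-- If the order of `C` divides `n / d` then `χ(C) ζ ^ (-i d)` lies in `ℚ(ζ ^ d)`,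
so that its trace over `ℚ` makes sense. -/
theorem classChar_mul_mem [FiniteDimensional ℂ V] [Finite G] {n : ℕ} {ζ : ℂ}
    (hζ : IsPrimitiveRoot ζ n) (ρ : Representation ℂ G V) (i : ℤ)
    (d : n.divisors) (C : Cl G (n / (d : ℕ))) :
    classChar ρ (C : ConjClasses G) * ζ ^ (-(i * ((d : ℕ) : ℤ))) ∈
      IntermediateField.adjoin ℚ {ζ ^ (d : ℕ)} := by
  obtain ⟨d, hd⟩ := d
  obtain ⟨C, hC⟩ := C
  obtain ⟨hdn, hn⟩ := Nat.mem_divisors.1 hd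
  have hz : ζ ^ d ∈ IntermediateField.adjoin ℚ {ζ ^ d} :=
    IntermediateField.subset_adjoin _ _ rfl
  refine mul_mem ?_ ?_
  · obtain ⟨g, rfl⟩ := ConjClasses.exists_rep C
    rw [mem_Cl, classOrder_mk, orderOf_dvd_iff_pow_eq_one] at hC
    have hprim : IsPrimitiveRoot (ζ ^ d) (n / d) :=
      hζ.pow (Nat.pos_of_ne_zero hn) (Nat.mul_div_cancel' hdn).symm
    have hm : NeZero (n / d) :=
      ⟨(Nat.div_pos (Nat.le_of_dvd (Nat.pos_of_ne_zero hn) hdn)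
        (Nat.pos_of_mem_divisors hd)).ne'⟩
    show LinearMap.trace ℂ V (ρ g) ∈ _
    rw [Module.End.trace_eq_sum_roots_charpoly_of_splits (IsAlgClosed.splits _)]
    refine multiset_sum_mem _ fun x hx => ?_
    have hev : Module.End.HasEigenvalue (ρ g) x := by
      rw [Module.End.hasEigenvalue_iff_isRoot_charpoly]
      exact (Polynomial.mem_roots'.1 hx).2
    obtain ⟨v, hv⟩ := hev.exists_hasEigenvector
    have hp : (ρ g ^ (n / d)) v = x ^ (n / d) • v := hv.pow_apply _
    rw [← map_pow, hC, map_one, Module.End.one_apply] at hp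
    have hx1 : x ^ (n / d) = 1 := by
      have h0 : (x ^ (n / d) - 1) • v = 0 := by rw [sub_smul, one_smul, ← hp, sub_self]
      exact sub_eq_zero.1 ((smul_eq_zero.1 h0).resolve_right hv.2)
    obtain ⟨k, -, rfl⟩ := hprim.eq_pow_of_pow_eq_one hx1
    exact pow_mem hz k
  · rw [mul_comm, ← mul_neg, zpow_mul, zpow_natCast]
    exact zpow_mem hz _

end GroupRingUnits

end

/-! ### Jordan blocks in characteristic p -/

open Module

/-! Since `ρ(u)^n = 1`, `ρ(u)` is diagonalizable; let `μ_j` be the multiplicity of `ζ^j`. If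
`ε_C(u^d) = 0` for every `C` outside `Cl_{n/d}`, the inner sum over `C` is the trace from `ℚ(ζ^d)`
of `tr ρ(u^d) ζ^(-id) = ∑_j μ_j ζ^(d(j-i))`, that is, the sum of `F(x) = ∑_j μ_j x^(j-i)` over the
primitive `n/d`-th roots of unity. Summing over `d` reaches every `n`-th root of unity once, and
orthogonality leaves `n μ_i`.

The substance is the vanishing, `partialAug_eq_zero`. If `v^k = 1` and the order of `x` does not
divide `k`, let `A` act on `ℤG` by left multiplication by `v` and right multiplication by `x`. Its
trace is `|C_G(x)|` times the partial augmentation of `v` at the class of `x`. For some prime `p`, a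
power of `A` is right multiplication by an element of order `p`, which permutes `G` freely. This
freeness makes the Jordan blocks of `A` modulo `p` so long that the complex eigenvalue
multiplicities depend only on the residues of the eigenvalues. They are then invariant under
multiplication by a primitive `p`-th root of unity, so the trace is zero. -/

theorem LinearMap.succ_mul_finrank_ker_le {K V : Type*} [Field K] [AddCommGroup V] [Module K V]
    [FiniteDimensional K V] (X : End K V) (r : ℕ)
    (h : LinearMap.ker X ≤ LinearMap.range (X ^ r)) :
    (r + 1) * finrank K (LinearMap.ker X) ≤ finrank K V := by
  -- Each of the first `r + 1` applications of `X` loses the whole of `ker X`, which still lies in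
  -- the current image.
  have step : ∀ j, j ≤ r + 1 →
      finrank K (LinearMap.range (X ^ j)) + j * finrank K (LinearMap.ker X) ≤ finrank K V := by
    intro j
    induction j with
    | zero => intro _; simpa using Submodule.finrank_le _
    | succ j ih =>
      intro hj
      have hker : LinearMap.ker X ≤ LinearMap.range (X ^ j) := by
        refine h.trans ?_
        obtain ⟨c, rfl⟩ : ∃ c, r = j + c := ⟨r - j, by omega⟩
        rw [pow_add]
        exact LinearMap.range_comp_le_range _ _
      have h1 := LinearMap.finrank_range_add_finrank_ker (X.domRestrict (LinearMap.range (X ^ j)))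
      have h2 : LinearMap.range (X.domRestrict (LinearMap.range (X ^ j))) =
          LinearMap.range (X ^ (j + 1)) := by
        rw [LinearMap.range_domRestrict, pow_succ', ← LinearMap.range_comp]
        rfl
      have h3 : finrank K (LinearMap.ker (X.domRestrict (LinearMap.range (X ^ j)))) =
          finrank K (LinearMap.ker X) := by
        rw [LinearMap.ker_domRestrict]
        exact (Submodule.comapSubtypeEquivOfLe hker).finrank_eq
      rw [h2, h3] at h1
      have := ih (by omega)
      linarith
  have := step (r + 1) le_rfl
  omega

/-- With `X = S - 1`, the hypothesis reads `ker X^(p^b) ≤ range X^(p^b (p-1))`. It forces every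
Jordan block of `S` at the eigenvalue 1 to have size at least `p^(b+1)`. -/
theorem Module.End.pow_prime_mul_finrank_ker_le {K V : Type*} [Field K] [AddCommGroup V]
    [Module K V] [FiniteDimensional K V] (p : ℕ) [hp : Fact p.Prime] [CharP K p]
    (S : End K V) (b : ℕ)
    (h : LinearMap.ker (S ^ p ^ b - 1) ≤
      LinearMap.range (∑ j ∈ Finset.range p, (S ^ p ^ b) ^ j)) :
    p ^ (b + 1) * finrank K (LinearMap.ker (S - 1)) ≤ finrank K V := by
  have hp2 := hp.out.two_le
  -- The Frobenius identities need a commutative ring, so they are proved in `K[X]` and evaluated at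
  -- `S`.
  have geom : ∑ j ∈ Finset.range p, (S ^ p ^ b) ^ j = (S - 1) ^ (p ^ b * (p - 1)) := by
    have key : ∑ j ∈ Finset.range p, ((Polynomial.X : Polynomial K) ^ p ^ b) ^ j =
        (Polynomial.X - 1) ^ (p ^ b * (p - 1)) := by
      have h0 : (Polynomial.X - 1 : Polynomial K) ≠ 0 := by
        simpa using Polynomial.X_sub_C_ne_zero (1 : K)
      apply mul_right_cancel₀ (pow_ne_zero (p ^ b) h0)
      rw [← pow_add, show p ^ b * (p - 1) + p ^ b = p ^ (b + 1) by
        rw [pow_succ, ← Nat.mul_succ, Nat.succ_eq_add_one, Nat.sub_add_cancel hp.out.one_le], sub_pow_char_pow, sub_pow_char_pow, one_pow, one_pow, geom_sum_mul,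
        ← pow_mul, ← pow_succ]
    simpa using congrArg (Polynomial.aeval S) key
  have hq : S ^ p ^ b - 1 = (S - 1) ^ p ^ b := by
    have key : (Polynomial.X : Polynomial K) ^ p ^ b - 1 = (Polynomial.X - 1) ^ p ^ b := by
      rw [sub_pow_char_pow, one_pow]
    simpa using congrArg (Polynomial.aeval S) key
  rw [geom, hq] at h
  set X : End K V := S - 1
  set q := p ^ b
  have hqpos : 0 < q := Nat.pow_pos hp.out.pos
  have hr : p ^ (b + 1) = (q * (p - 1) + (q - 1)) + 1 := by
    have : q * (p - 1) + q = q * p := by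
      rw [← Nat.mul_succ, Nat.succ_eq_add_one, Nat.sub_add_cancel hp.out.one_le]
    rw [pow_succ]
    change q * p = _
    omega
  rw [hr]
  apply LinearMap.succ_mul_finrank_ker_le
  intro v hv
  have hv0 : X v = 0 := hv
  have hker : ∀ w, (X ^ q) w = 0 → ∃ w', (X ^ (q * (p - 1))) w' = w := fun w hw => h hw
  -- The hypothesis is used twice: `v = X^(q(p-1)) w`, and then `X^(q(p-2)+1) w`, which `X^q` kills,
  -- equals `X^(q(p-1)) w'`. Hence `v = X^(qp-1) w'`.
  obtain ⟨w, hw⟩ := hker v (by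
    obtain ⟨c, hc⟩ : ∃ c, q = c + 1 := ⟨q - 1, by omega⟩
    rw [hc, pow_succ, Module.End.mul_apply, hv0, map_zero])
  have e1 : q * (p - 1) = (q - 1) + (q * (p - 2) + 1) := by
    have : q * (p - 1) = q * (p - 2) + q := by
      conv_lhs => rw [show p - 1 = (p - 2) + 1 by omega]
      simp [Nat.mul_add]
    omega
  obtain ⟨w', hw'⟩ := hker ((X ^ (q * (p - 2) + 1)) w) (by
    rw [← Module.End.mul_apply, ← pow_add,
      show q + (q * (p - 2) + 1) = 1 + ((q - 1) + (q * (p - 2) + 1)) by omega, ← e1, pow_add,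
      Module.End.mul_apply, hw, pow_one, hv0])
  refine ⟨w', ?_⟩
  rw [add_comm, pow_add, Module.End.mul_apply, hw', ← Module.End.mul_apply, ← pow_add, ← e1, hw]

theorem Module.End.sum_finrank_eigenspace_le {K V : Type*} [Field K] [AddCommGroup V] [Module K V]
    [FiniteDimensional K V] (f : End K V) (s : Finset K) (W : Submodule K V)
    (h : ∀ a ∈ s, f.eigenspace a ≤ W) :
    ∑ a ∈ s, finrank K (f.eigenspace a) ≤ finrank K W := by
  classical
  have hind : iSupIndep fun a : s => f.eigenspace (a : K) :=
    f.eigenspaces_iSupIndep.comp Subtype.val_injective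
  have hinj := hind.dfinsupp_lsum_injective
  have hle : LinearMap.range (DFinsupp.lsum ℕ fun a : s => (f.eigenspace (a : K)).subtype) ≤ W := by
    rw [← Submodule.iSup_eq_range_dfinsupp_lsum]
    exact iSup_le fun a => h a a.2
  have h1 := LinearMap.finrank_range_of_inj hinj
  have h2 : finrank K (Π₀ a : s, f.eigenspace (a : K)) =
      ∑ a ∈ s, finrank K (f.eigenspace a) := by
    have := Module.finrank_directSum (R := K) (fun a : s => f.eigenspace (a : K))
    rw [← Finset.sum_coe_sort]
    exact this
  rw [← h2, ← h1]
  exact Submodule.finrank_mono hle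

/-! ### Endomorphisms of finite order -/

section FiniteOrder

variable {K V : Type*} [Field K] [AddCommGroup V] [Module K V] {f : End K V} {n : ℕ}

theorem Module.End.isSemisimple_of_pow_eq_one [FiniteDimensional K V] (hn : (n : K) ≠ 0) (hf : f ^ n = 1) :
    f.IsSemisimple :=
  isSemisimple_of_squarefree_aeval_eq_zero
    (p := Polynomial.X ^ n - 1) ((Polynomial.X_pow_sub_one_separable_iff).2 hn).squarefree
    (by simp [hf])

theorem Module.End.eigenspace_eq_bot_of_pow_eq_one (hf : f ^ n = 1) {a : K} (ha : a ^ n ≠ 1) :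
    f.eigenspace a = ⊥ := by
  rw [eq_bot_iff]
  intro v hv
  by_contra hv0
  have hev : f.HasEigenvector a v := ⟨hv, hv0⟩
  have h1 := hev.pow_apply n
  rw [hf, one_apply] at h1
  apply ha
  have h0 : (a ^ n - 1) • v = 0 := by rw [sub_smul, one_smul, ← h1, sub_self]
  exact sub_eq_zero.1 ((smul_eq_zero.1 h0).resolve_right hv0)

theorem Module.End.trace_pow_eq_sum_finrank_eigenspace [FiniteDimensional K V] [IsAlgClosed K] (hn : (n : K) ≠ 0)
    (hf : f ^ n = 1) (k : ℕ) :
    LinearMap.trace K V (f ^ k) =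
      ∑ a ∈ Polynomial.nthRootsFinset n (1 : K), finrank K (f.eigenspace a) * a ^ k := by
  classical
  have hn0 : 0 < n := Nat.pos_of_ne_zero (by rintro rfl; simp at hn)
  have hint : DirectSum.IsInternal fun a : K => f.eigenspace a :=
    DirectSum.isInternal_submodule_of_iSupIndep_of_iSup_eq_top f.eigenspaces_iSupIndep
      (isSemisimple_of_pow_eq_one hn hf).iSup_eigenspace_eq_top
  have hfin : {a : K | f.eigenspace a ≠ ⊥}.Finite :=
    (Polynomial.nthRootsFinset n (1 : K)).finite_toSet.subset fun a ha => by
      rw [Finset.mem_coe, Polynomial.mem_nthRootsFinset hn0]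
      exact not_imp_comm.1 (fun h => eigenspace_eq_bot_of_pow_eq_one hf h) ha
  have hmaps : ∀ a : K, Set.MapsTo (f ^ k) (f.eigenspace a) (f.eigenspace a) := fun a =>
    mapsTo_genEigenspace_of_comm (Commute.pow_self f k).symm a 1
  rw [LinearMap.trace_eq_sum_trace_restrict' hint hfin hmaps]
  have hterm : ∀ a : K, LinearMap.trace K (f.eigenspace a) ((f ^ k).restrict (hmaps a)) =
      finrank K (f.eigenspace a) * a ^ k := by
    intro a
    have : (f ^ k).restrict (hmaps a) = (a ^ k) • LinearMap.id := by
      ext ⟨v, hv⟩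
      change (f ^ k) v = a ^ k • v
      by_cases hv0 : v = 0
      · simp [hv0]
      · have hev : f.HasEigenvector a v := ⟨hv, hv0⟩
        exact hev.pow_apply k
    rw [this, map_smul, LinearMap.trace_id, smul_eq_mul, mul_comm]
  rw [Finset.sum_congr rfl fun a _ => hterm a]
  refine Finset.sum_subset ?_ ?_
  · intro a ha
    rw [Polynomial.mem_nthRootsFinset hn0]
    rw [Set.Finite.mem_toFinset] at ha
    exact not_imp_comm.1 (fun h => eigenspace_eq_bot_of_pow_eq_one hf h) ha
  · intro a _ ha
    have : f.eigenspace a = ⊥ := by simpa using ha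
    rw [this, finrank_bot, Nat.cast_zero, zero_mul]

theorem Module.End.rootMultiplicity_charpoly_of_pow_eq_one [FiniteDimensional K V] (hn : (n : K) ≠ 0)
    (hf : f ^ n = 1) (a : K) :
    f.charpoly.rootMultiplicity a = finrank K (f.eigenspace a) := by
  rw [← LinearMap.finrank_maxGenEigenspace_eq,
    (isSemisimple_of_pow_eq_one hn hf).isFinitelySemisimple.maxGenEigenspace_eq_eigenspace]

end FiniteOrder

/-! ### Reduction at a valuation ring -/

section Reduction

variable {ι K : Type*} [Field K] (W : ValuationSubring K)

/-- Dividing a relation by its coefficient of largest valuation makes that coefficient 1, so the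
relation survives reduction. -/
theorem ValuationSubring.linearIndependent_of_residue {κ : Type*} [Fintype κ] (v : κ → ι → W)
    (h : LinearIndependent (IsLocalRing.ResidueField W)
      fun j i => IsLocalRing.residue W (v j i)) :
    LinearIndependent K fun j i => (v j i : K) := by
  rw [← LinearIndependent.iff_fractionRing W K, Fintype.linearIndependent_iff]
  intro c hc
  by_contra! hne
  obtain ⟨j₁, hj₁⟩ := hne
  have : Nonempty κ := ⟨j₁⟩
  obtain ⟨j₀, hj₀⟩ := Finite.exists_max fun j => W.valuation (c j : K)
  have hdiv : ∀ j, ∃ b : W, c j = b * c j₀ := fun j => by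
    obtain ⟨b, hb⟩ := (W.valuation_le_iff _ _).1 (hj₀ j)
    exact ⟨b, Subtype.ext hb.symm⟩
  choose b hb using hdiv
  have hc0 : c j₀ ≠ 0 := fun h0 => hj₁ (by rw [hb j₁, h0, mul_zero])
  have hsum : ∀ i, ∑ j, b j * v j i = 0 := by
    intro i
    have h1 := congrFun hc i
    simp only [Finset.sum_apply, Pi.smul_apply, Pi.zero_apply] at h1
    have h2 : ∑ j, c j * v j i = 0 := by
      apply Subtype.val_injective
      simpa [Algebra.smul_def] using h1
    have h3 : c j₀ * ∑ j, b j * v j i = 0 := by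
      rw [Finset.mul_sum, ← h2]
      exact Finset.sum_congr rfl fun j _ => by rw [hb j]; ring
    exact (mul_eq_zero.1 h3).resolve_left hc0
  have h4 := Fintype.linearIndependent_iff.1 h (fun j => IsLocalRing.residue W (b j)) (by
    ext i
    simpa using congrArg (IsLocalRing.residue W) (hsum i)) j₀
  have h5 : b j₀ = 1 := mul_right_cancel₀ hc0 (by rw [← hb j₀, one_mul])
  rw [h5, map_one] at h4
  exact one_ne_zero h4

theorem ValuationSubring.rank_map_residue_le [Fintype ι] (A : Matrix ι ι W) :
    (A.map (IsLocalRing.residue W)).rank ≤ (A.map W.subtype).rank := by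
  obtain ⟨κ, a, ha, hspan, hlin⟩ := exists_linearIndependent' (IsLocalRing.ResidueField W)
    (A.map (IsLocalRing.residue W)).col
  have : Finite κ := Finite.of_injective a ha
  have : Fintype κ := Fintype.ofFinite κ
  have hlin' := W.linearIndependent_of_residue (fun j i => A i (a j)) hlin
  rw [Matrix.rank_eq_finrank_span_cols, Matrix.rank_eq_finrank_span_cols, ← hspan,
    finrank_span_eq_card hlin, ← finrank_span_eq_card hlin']
  apply Submodule.finrank_mono
  apply Submodule.span_mono
  rintro _ ⟨j, rfl⟩
  exact ⟨a j, rfl⟩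

theorem ValuationSubring.finrank_ker_le_finrank_ker_residue [Fintype ι] (A : Matrix ι ι W) :
    finrank K (LinearMap.ker (A.map W.subtype).mulVecLin) ≤
      finrank (IsLocalRing.ResidueField W)
        (LinearMap.ker (A.map (IsLocalRing.residue W)).mulVecLin) := by
  have h1 := LinearMap.finrank_range_add_finrank_ker (A.map W.subtype).mulVecLin
  have h2 := LinearMap.finrank_range_add_finrank_ker
    (A.map (IsLocalRing.residue W)).mulVecLin
  have h3 := W.rank_map_residue_le A
  rw [Module.finrank_fintype_fun_eq_card] at h1 h2
  simp only [Matrix.rank] at h3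
  omega

end Reduction

theorem ValuationSubring.mem_of_pow_eq_one {K : Type*} [Field K] (W : ValuationSubring K) {a : K}
    {n : ℕ} (hn : n ≠ 0) (ha : a ^ n = 1) : a ∈ W := by
  rw [← W.valuation_le_one_iff]
  have h := congrArg W.valuation ha
  rw [map_pow, map_one] at h
  exact not_lt.1 fun hlt => (one_lt_pow₀ hlt hn).ne' h

/-- The ideal `(p)` of the image of `ℤ` is proper, so some valuation ring of `K` has it among its
nonunits. -/
theorem exists_valuationSubring_charP (K : Type*) [Field K] [CharZero K] (p : ℕ)
    [hp : Fact p.Prime] :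
    ∃ W : ValuationSubring K, CharP (IsLocalRing.ResidueField W) p := by
  let B : Subring K := (Int.castRingHom K).range
  let x : B := ⟨(p : K), (p : ℤ), by simp⟩
  have hx : Ideal.span {x} ≠ ⊤ := by
    rw [Ne, Ideal.span_singleton_eq_top, isUnit_iff_exists_inv]
    rintro ⟨⟨_, y, rfl⟩, hy⟩
    have h1 : (p : K) * (y : K) = 1 := congrArg Subtype.val hy
    have h2 : (p : ℤ) * y = 1 := by exact_mod_cast h1
    exact (Nat.prime_iff_prime_int.1 hp.out).not_isUnit (IsUnit.of_mul_eq_one _ h2)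
  obtain ⟨W, -, hW⟩ := Ideal.image_subset_nonunits_valuationSubring _ hx
  refine ⟨W, ?_⟩
  have hpW : (p : K) ∈ W.nonunits := hW ⟨x, Ideal.mem_span_singleton_self x, rfl⟩
  have h0 : ((p : ℕ) : IsLocalRing.ResidueField W) = 0 := by
    rw [← map_natCast (IsLocalRing.residue W), IsLocalRing.residue_eq_zero_iff,
      IsLocalRing.mem_maximalIdeal]
    rw [ValuationSubring.mem_nonunits_iff_exists_mem_maximalIdeal] at hpW
    obtain ⟨h, h'⟩ := hpW
    have : ((p : ℕ) : W) = ⟨(p : K), h⟩ := Subtype.ext (by simp)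
    rw [this]
    exact h'
  exact (CharP.charP_iff_prime_eq_zero hp.out).2 h0

theorem ValuationSubring.eq_one_of_residue_eq_one {K : Type*} [Field K] (W : ValuationSubring K)
    {m : ℕ} (hm : (m : IsLocalRing.ResidueField W) ≠ 0) {x : W} (hx : x ^ m = 1)
    (h : IsLocalRing.residue W x = 1) : x = 1 := by
  by_contra hne
  have h0 : (∑ j ∈ Finset.range m, x ^ j) * (x - 1) = 0 := by rw [geom_sum_mul, hx, sub_self]
  have h1 := (mul_eq_zero.1 h0).resolve_right (sub_ne_zero.2 hne)
  have h2 := congrArg (IsLocalRing.residue W) h1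
  simp [h] at h2
  exact hm h2

/-! ### Trace zero from relative projectivity -/

namespace Matrix

variable {ι : Type*} [Fintype ι] [DecidableEq ι]

/-- The endomorphism of `ι → R` defined by an integral matrix. -/
noncomputable def intToEnd (ι R : Type*) [Fintype ι] [DecidableEq ι] [CommRing R] :
    Matrix ι ι ℤ →+* End R (ι → R) :=
  ((toLinAlgEquiv' : Matrix ι ι R ≃ₐ[R] End R (ι → R)) : Matrix ι ι R →+* End R (ι → R)).comp
    (Int.castRingHom R).mapMatrix

theorem trace_intToEnd {R : Type*} [CommRing R] (A : Matrix ι ι ℤ) :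
    LinearMap.trace R (ι → R) (intToEnd ι R A) = (A.trace : R) := by
  change LinearMap.trace R (ι → R) (toLin' (A.map (Int.cast : ℤ → R))) = _
  rw [trace_toLin'_eq]
  simp [trace]

/-- The rank of `A - a` cannot grow under reduction. -/
theorem finrank_eigenspace_le_residue {K : Type*} [Field K] (W : ValuationSubring K)
    (A : Matrix ι ι ℤ) (a : W) :
    finrank K ((intToEnd ι K A).eigenspace (a : K)) ≤
      finrank (IsLocalRing.ResidueField W)
        ((intToEnd ι (IsLocalRing.ResidueField W) A).eigenspace (IsLocalRing.residue W a)) := by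
  have h := W.finrank_ker_le_finrank_ker_residue (A.map (Int.cast : ℤ → W) - a • 1)
  have key : ∀ {R : Type _} [CommRing R] (g : W →+* R),
      LinearMap.ker ((A.map (Int.cast : ℤ → W) - a • 1).map g).mulVecLin =
        (intToEnd ι R A).eigenspace (g a) := by
    intro R _ g
    ext v
    rw [LinearMap.mem_ker, Module.End.mem_eigenspace_iff, ← sub_eq_zero (b := g a • v)]
    have : (A.map (Int.cast : ℤ → W) - a • 1).map g = A.map (Int.cast : ℤ → R) - g a • 1 := by
      ext i j
      by_cases hij : i = j <;> simp [hij]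
    rw [this, mulVecLin_apply, sub_mulVec, smul_mulVec, one_mulVec]
    rfl
  have k1 := key W.subtype
  have k2 := key (IsLocalRing.residue W)
  rw [← k2]
  simp only [ValuationSubring.subtype_apply] at k1
  rw [← k1]
  exact h

/-- The ratio of two elements of a fiber reduces to 1. Its `q`-th power is an `m`-th root of unity
reducing to 1, hence is 1 because `m` is invertible in the residue field. So the ratios are `q`-th
roots of unity. -/
theorem card_roots_residue_fiber_le {K : Type*} [Field K] (W : ValuationSubring K) {q m : ℕ}
    (hm : (m : IsLocalRing.ResidueField W) ≠ 0) (hq : q ≠ 0) (s : Finset W)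
    (hs : ∀ x ∈ s, x ^ (q * m) = 1) (l : IsLocalRing.ResidueField W)
    (hl : ∀ x ∈ s, IsLocalRing.residue W x = l) : s.card ≤ q := by
  classical
  rcases s.eq_empty_or_nonempty with rfl | ⟨x₀, hx₀⟩
  · simp
  have hm0 : m ≠ 0 := by rintro rfl; simp at hm
  have hqm : q * m ≠ 0 := mul_ne_zero hq hm0
  have hu : IsUnit x₀ := IsUnit.of_pow_eq_one (hs x₀ hx₀) hqm
  obtain ⟨y, hy⟩ := hu.exists_right_inv
  have hyl : IsLocalRing.residue W y * l = 1 := by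
    rw [← hl x₀ hx₀, ← map_mul, mul_comm, hy, map_one]
  have hyN : y ^ (q * m) = 1 := by
    have := congrArg (· ^ (q * m)) hy
    simpa [mul_pow, hs x₀ hx₀] using this
  have hmap : ∀ x ∈ s, y * x ∈ Polynomial.nthRootsFinset q (1 : W) := by
    intro x hx
    rw [Polynomial.mem_nthRootsFinset (Nat.pos_of_ne_zero hq)]
    apply W.eq_one_of_residue_eq_one hm
    · rw [← pow_mul, mul_pow, hyN, hs x hx, one_mul]
    · rw [map_pow, map_mul, hl x hx, hyl, one_pow]
  have hinj : Set.InjOn (fun x => y * x) s := fun x _ x' _ h => by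
    have := congrArg (x₀ * ·) h
    simpa [← mul_assoc, hy] using this
  refine (Finset.card_le_card_of_injOn _ hmap hinj).trans ?_
  rw [Polynomial.nthRootsFinset_def]
  exact (Multiset.toFinset_card_le _).trans (Polynomial.card_nthRoots _ _)

/-- Applied to a vector `v` fixed by `A^(p^b m)`, the identity `hC` exhibits `v` as the norm of `C
v`. -/
theorem pow_prime_mul_finrank_ker_le {k : Type*} [Field k] (p : ℕ) [hp : Fact p.Prime] [CharP k p]
    (A C : Matrix ι ι ℤ) (b m : ℕ)
    (hC : ∑ j ∈ Finset.range p, (A ^ (p ^ b * m)) ^ j * C * (A ^ (p ^ b * m)) ^ (p - j) = 1) :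
    p ^ (b + 1) * finrank k (LinearMap.ker (intToEnd ι k A ^ m - 1)) ≤ Fintype.card ι := by
  rw [← Module.finrank_fintype_fun_eq_card k]
  apply Module.End.pow_prime_mul_finrank_ker_le p
  intro v hv
  rw [← pow_mul, mul_comm m] at hv ⊢
  have hv1 : (intToEnd ι k A ^ (p ^ b * m)) v = v := by
    rw [LinearMap.mem_ker, LinearMap.sub_apply, Module.End.one_apply] at hv
    exact sub_eq_zero.1 hv
  have hvj : ∀ j, ((intToEnd ι k A ^ (p ^ b * m)) ^ j) v = v := by
    intro j
    induction j with
    | zero => simp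
    | succ j ih => rw [pow_succ, Module.End.mul_apply, hv1, ih]
  refine ⟨intToEnd ι k C v, ?_⟩
  have h := congrArg (fun f => (intToEnd ι k f) v) hC
  simp only [map_sum, map_mul, map_pow, map_one, LinearMap.sum_apply, Module.End.mul_apply,
    Module.End.one_apply, hvj] at h
  rw [LinearMap.sum_apply]
  exact h

/-- An integral matrix `A` of finite order has trace zero if the lattice it acts on is relatively
projective over the trivial subgroup for the subgroup of order `p` generated by a power of `A`. -/
theorem trace_eq_zero_of_relativelyProjective (p : ℕ) [hp : Fact p.Prime]
    (A C : Matrix ι ι ℤ) (b m : ℕ) (hm : ¬ p ∣ m) (hA : A ^ (p ^ (b + 1) * m) = 1)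
    (hC : ∑ j ∈ Finset.range p, (A ^ (p ^ b * m)) ^ j * C * (A ^ (p ^ b * m)) ^ (p - j) = 1) :
    A.trace = 0 := by
  classical
  obtain ⟨W, hW⟩ := exists_valuationSubring_charP ℂ p
  set k := IsLocalRing.ResidueField W
  set q := p ^ (b + 1)
  have hq : q ≠ 0 := pow_ne_zero _ hp.out.ne_zero
  have hm0 : m ≠ 0 := by rintro rfl; exact hm (dvd_zero p)
  have hN : 0 < q * m := Nat.pos_of_ne_zero (mul_ne_zero hq hm0)
  have hmk : (m : k) ≠ 0 := by rwa [Ne, CharP.cast_eq_zero_iff k p]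
  set f := intToEnd ι ℂ A
  have hf : f ^ (q * m) = 1 := by rw [← map_pow, hA, map_one]
  have hNC : ((q * m : ℕ) : ℂ) ≠ 0 := Nat.cast_ne_zero.2 hN.ne'
  set fk := intToEnd ι k A
  set R := Polynomial.nthRootsFinset (q * m) (1 : ℂ)
  have hR : ∀ {w}, w ∈ R ↔ w ^ (q * m) = 1 := Polynomial.mem_nthRootsFinset hN _
  have hRW : ∀ {w}, w ∈ R → w ∈ W := fun h => W.mem_of_pow_eq_one hN.ne' (hR.1 h)
  -- The default 0 plays no role: roots of unity lie in `W`.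
  let res : ℂ → k := fun w => if h : w ∈ W then IsLocalRing.residue W ⟨w, h⟩ else 0
  have res_eq : ∀ {w} (h : w ∈ W), res w = IsLocalRing.residue W ⟨w, h⟩ := fun h => dif_pos h
  have hle : ∀ w ∈ R, finrank ℂ (f.eigenspace w) ≤ finrank k (fk.eigenspace (res w)) := by
    intro w hw
    rw [res_eq (hRW hw)]
    exact finrank_eigenspace_le_residue W A ⟨w, hRW hw⟩
  have hsum : ∑ w ∈ R, finrank ℂ (f.eigenspace w) = Fintype.card ι := by
    have h := Module.End.trace_pow_eq_sum_finrank_eigenspace hNC hf 0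
    simp only [pow_zero, mul_one, LinearMap.trace_one, Module.finrank_fintype_fun_eq_card] at h
    exact_mod_cast h.symm
  have hmaps : ∀ w ∈ R, res w ∈ Polynomial.nthRootsFinset m (1 : k) := by
    intro w hw
    rw [Polynomial.mem_nthRootsFinset (Nat.pos_of_ne_zero hm0), res_eq (hRW hw)]
    have h1 : (IsLocalRing.residue W ⟨w, hRW hw⟩ ^ m) ^ q = 1 := by
      rw [← pow_mul, mul_comm m q, ← map_pow]
      have : (⟨w, hRW hw⟩ : W) ^ (q * m) = 1 := Subtype.ext (hR.1 hw)
      rw [this, map_one]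
    have h2 : (IsLocalRing.residue W ⟨w, hRW hw⟩ ^ m - 1) ^ q = 0 := by
      rw [sub_pow_char_pow, h1, one_pow, sub_self]
    exact sub_eq_zero.1 (pow_eq_zero_iff hq |>.1 h2)
  -- Fibers of `res` have at most `q` elements, and the eigenspaces of `fk` at `m`-th roots of unity
  -- are independent inside `ker (fk^m - 1)`, whose dimension times `q` is at most the rank.
  have hupper : ∑ w ∈ R, finrank k (fk.eigenspace (res w)) ≤ Fintype.card ι := by
    rw [← Finset.sum_fiberwise_of_maps_to hmaps]
    refine le_trans ?_ (pow_prime_mul_finrank_ker_le (k := k) p A C b m hC)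
    refine le_trans ?_ (Nat.mul_le_mul_left q (fk.sum_finrank_eigenspace_le
      (Polynomial.nthRootsFinset m (1 : k)) (LinearMap.ker (fk ^ m - 1)) ?_))
    · rw [Finset.mul_sum]
      refine Finset.sum_le_sum fun l _ => ?_
      rw [Finset.sum_congr rfl (g := fun _ => finrank k (fk.eigenspace l)) fun w hw => by
        rw [(Finset.mem_filter.1 hw).2], Finset.sum_const, smul_eq_mul]
      refine Nat.mul_le_mul_right _ ?_
      have hcard := card_roots_residue_fiber_le W hmk hq
        ((R.filter fun w => res w = l).subtype (· ∈ W)) (fun x hx => Subtype.ext <| hR.1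
          (Finset.mem_filter.1 (Finset.mem_subtype.1 hx)).1) l (fun x hx => by
          rw [← (Finset.mem_filter.1 (Finset.mem_subtype.1 hx)).2, res_eq x.2])
      rwa [Finset.card_subtype, Finset.filter_true_of_mem
        fun w hw => hRW (Finset.mem_filter.1 hw).1] at hcard
    · intro l hl v hv
      rw [Polynomial.mem_nthRootsFinset (Nat.pos_of_ne_zero hm0)] at hl
      rw [LinearMap.mem_ker, LinearMap.sub_apply, Module.End.one_apply, sub_eq_zero]
      by_cases hv0 : v = 0
      · simp [hv0]
      · have hev : fk.HasEigenvector l v := ⟨hv, hv0⟩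
        rw [hev.pow_apply, hl, one_smul]
  -- The upper bound equals the total complex dimension, so every termwise inequality is an
  -- equality.
  have heq : ∀ w ∈ R, finrank ℂ (f.eigenspace w) = finrank k (fk.eigenspace (res w)) :=
    (Finset.sum_eq_sum_iff_of_le hle).1 (le_antisymm (Finset.sum_le_sum hle) (hsum ▸ hupper))
  -- As `z` reduces to 1 in characteristic `p`, `w` and `z w` have the same residue, hence the same
  -- multiplicity.
  obtain ⟨z, hz⟩ : ∃ z : ℂ, IsPrimitiveRoot z p := ⟨_, Complex.isPrimitiveRoot_exp p hp.out.ne_zero⟩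
  have hzN : z ^ (q * m) = 1 := by
    rw [show q * m = p * (p ^ b * m) by simp only [q]; ring, pow_mul, hz.pow_eq_one, one_pow]
  have hzW : z ∈ W := hRW (hR.2 hzN)
  have hzres : IsLocalRing.residue W ⟨z, hzW⟩ = 1 := by
    have : (⟨z, hzW⟩ : W) ^ p = 1 := Subtype.ext hz.pow_eq_one
    have h2 : (IsLocalRing.residue W ⟨z, hzW⟩ - 1) ^ p = 0 := by
      rw [sub_pow_char, ← map_pow, this, map_one, one_pow, sub_self]
    exact sub_eq_zero.1 (pow_eq_zero_iff hp.out.ne_zero |>.1 h2)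
  have hshift : ∀ w ∈ R, finrank ℂ (f.eigenspace (z * w)) = finrank ℂ (f.eigenspace w) := by
    intro w hw
    have hzw : z * w ∈ R := hR.2 (by rw [mul_pow, hzN, hR.1 hw, one_mul])
    rw [heq _ hzw, heq _ hw]
    have : res (z * w) = res w := by
      rw [res_eq (hRW hzw), res_eq (hRW hw)]
      have : (⟨z * w, hRW hzw⟩ : W) = ⟨z, hzW⟩ * ⟨w, hRW hw⟩ := rfl
      rw [this, map_mul, hzres, one_mul]
    rw [this]
  have htr := Module.End.trace_pow_eq_sum_finrank_eigenspace hNC hf 1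
  rw [pow_one, trace_intToEnd] at htr
  have hmul : z * (A.trace : ℂ) = A.trace := by
    rw [htr, Finset.mul_sum]
    refine Finset.sum_bij (fun w _ => z * w) ?_ ?_ ?_ ?_
    · intro w hw
      exact hR.2 (by rw [mul_pow, hzN, hR.1 hw, one_mul])
    · intro w _ w' _ h
      exact mul_left_cancel₀ (hz.ne_zero hp.out.ne_zero) h
    · intro w hw
      refine ⟨z⁻¹ * w, hR.2 (by rw [mul_pow, inv_pow, hzN, hR.1 hw, inv_one, one_mul]), ?_⟩
      rw [mul_inv_cancel_left₀ (hz.ne_zero hp.out.ne_zero)]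
    · intro w hw
      rw [hshift w hw]
      ring
  have h0 : (z - 1) * (A.trace : ℂ) = 0 := by rw [sub_mul, hmul, one_mul, sub_self]
  exact_mod_cast (mul_eq_zero.1 h0).resolve_left
    (sub_ne_zero.2 (hz.ne_one hp.out.one_lt))

end Matrix

/-! ### Vanishing of partial augmentations -/

namespace GroupRingUnits

variable {G : Type*} [Group G]

/-- Take a prime `p` with larger exponent in `o` than in `k`. That exponent in `o` is `b + 1`, and
`m` is the product of the prime-to-`p` parts of `k` and `o`. -/
theorem exists_prime_pow_mul_of_not_dvd {o k : ℕ} (ho : o ≠ 0) (hk : k ≠ 0) (h : ¬ o ∣ k) :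
    ∃ p b m : ℕ, p.Prime ∧ ¬ p ∣ m ∧ k ∣ p ^ b * m ∧ o ∣ p ^ (b + 1) * m ∧ ¬ o ∣ p ^ b * m := by
  rw [Nat.dvd_iff_prime_pow_dvd_dvd] at h
  push Not at h
  obtain ⟨p, e, hp, heo, hek⟩ := h
  obtain ⟨E, o', ho', rfl⟩ := Nat.exists_eq_pow_mul_and_not_dvd ho p hp.ne_one
  obtain ⟨c, k', hk', rfl⟩ := Nat.exists_eq_pow_mul_and_not_dvd hk p hp.ne_one
  have hce : c < e := by
    by_contra! hle
    exact hek ((pow_dvd_pow p hle).mul_right k')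
  have heE : e ≤ E := by
    have := ((Nat.Prime.coprime_iff_not_dvd hp).2 ho').pow_left e
    exact (Nat.pow_dvd_pow_iff_le_right hp.one_lt).1 (this.dvd_of_dvd_mul_right heo)
  obtain ⟨b, rfl⟩ : ∃ b, E = b + 1 := ⟨E - 1, by omega⟩
  have hm : ¬ p ∣ k' * o' := fun h => (hp.dvd_mul.1 h).elim hk' ho'
  refine ⟨p, b, k' * o', hp, hm, ?_, ?_, ?_⟩
  · exact mul_dvd_mul (pow_dvd_pow p (by omega)) (dvd_mul_right _ _)
  · exact mul_dvd_mul dvd_rfl (dvd_mul_left _ _)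
  · intro hdvd
    have h1 : p ^ b * p ∣ p ^ b * (k' * o') := by
      rw [← pow_succ]
      exact (dvd_mul_right _ _).trans hdvd
    exact hm ((Nat.mul_dvd_mul_iff_left (Nat.pow_pos hp.pos)).1 h1)

/-- The conjugators from `x` to `g` form a left coset of the centralizer of `x`. -/
theorem ncard_conjugators_of_isConj {x g : G} (h : IsConj x g) :
    {h : G | h * x * h⁻¹ = g}.ncard = {h : G | h * x * h⁻¹ = x}.ncard := by
  obtain ⟨c, rfl⟩ := isConj_iff.1 h
  have : {h : G | h * x * h⁻¹ = c * x * c⁻¹} = (c * ·) '' {h : G | h * x * h⁻¹ = x} := by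
    ext h
    simp only [Set.image_mul_left, Set.mem_preimage, Set.mem_ofPred_eq]
    constructor
    · intro hh
      have : c⁻¹ * h * x * (c⁻¹ * h)⁻¹ = c⁻¹ * (h * x * h⁻¹) * c := by group
      rw [this, hh]
      group
    · intro hh
      have : h * x * h⁻¹ = c * (c⁻¹ * h * x * (c⁻¹ * h)⁻¹) * c⁻¹ := by group
      rw [this, hh]
  rw [this, Set.ncard_image_of_injective _ (mul_right_injective c)]

section

variable [DecidableEq G]

/-- The matrix of right multiplication by a group element. -/
def rightMulMatrix (x : G) : Matrix G G ℤ := (Equiv.mulRight x).permMatrix ℤ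

theorem rightMulMatrix_one : rightMulMatrix (1 : G) = 1 := by
  rw [rightMulMatrix, Equiv.mulRight_one, Matrix.permMatrix_one]

variable [Fintype G]

/-- The left regular representation of the integral group ring by integral matrices. -/
noncomputable def leftRegularMatrix (G : Type*) [Group G] [Fintype G] [DecidableEq G] :
    MonoidAlgebra ℤ G →ₐ[ℤ] Matrix G G ℤ :=
  MonoidAlgebra.lift ℤ (Matrix G G ℤ) G
    ((Matrix.permMatrixHom (R := ℤ)).comp (MulAction.toPermHom G G))

theorem rightMulMatrix_mul (x y : G) :
    rightMulMatrix (x * y) = rightMulMatrix x * rightMulMatrix y := by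
  rw [rightMulMatrix, Equiv.mulRight_mul, Matrix.permMatrix_mul]
  rfl

theorem rightMulMatrix_pow (x : G) (j : ℕ) : rightMulMatrix x ^ j = rightMulMatrix (x ^ j) := by
  induction j with
  | zero => rw [pow_zero, pow_zero, rightMulMatrix_one]
  | succ j ih => rw [pow_succ, pow_succ, ih, rightMulMatrix_mul]

theorem leftRegularMatrix_of_mul_rightMulMatrix (g x : G) :
    leftRegularMatrix G (MonoidAlgebra.of ℤ G g) * rightMulMatrix x =
      (Equiv.mulRight x * (Equiv.mulLeft g)⁻¹).permMatrix ℤ := by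
  rw [leftRegularMatrix, MonoidAlgebra.lift_of, Matrix.permMatrix_mul]
  rfl

theorem commute_leftRegularMatrix_rightMulMatrix (a : MonoidAlgebra ℤ G) (x : G) :
    Commute (leftRegularMatrix G a) (rightMulMatrix x) := by
  induction a using MonoidAlgebra.induction_on with
  | of g =>
    rw [Commute, SemiconjBy, leftRegularMatrix_of_mul_rightMulMatrix, leftRegularMatrix,
      MonoidAlgebra.lift_of, rightMulMatrix]
    change _ = _ * ((Equiv.mulLeft g)⁻¹).permMatrix ℤ
    rw [← Matrix.permMatrix_mul]
    congr 1
    ext h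
    change g⁻¹ * h * x = g⁻¹ * (h * x)
    rw [mul_assoc]
  | add a b ha hb => rw [map_add]; exact ha.add_left hb
  | smul r a ha => rw [map_smul]; exact ha.smul_left r

/-- The trace counts the fixed points of `h ↦ g⁻¹ h x`. -/
theorem trace_leftRegularMatrix_of_mul_rightMulMatrix (g x : G) :
    (leftRegularMatrix G (MonoidAlgebra.of ℤ G g) * rightMulMatrix x).trace =
      ({h : G | h * x * h⁻¹ = g}.ncard : ℤ) := by
  rw [leftRegularMatrix_of_mul_rightMulMatrix, Matrix.trace_permutation]
  congr 2
  ext h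
  simp only [Function.mem_fixedPoints, Function.IsFixedPt, Equiv.Perm.coe_mul,
    Function.comp_apply, Set.mem_ofPred_eq, Equiv.coe_mulRight]
  change g⁻¹ * h * x = h ↔ _
  rw [mul_inv_eq_iff_eq_mul, mul_assoc, inv_mul_eq_iff_eq_mul]

theorem trace_leftRegularMatrix_mul_rightMulMatrix (a : MonoidAlgebra ℤ G) (x : G) :
    (leftRegularMatrix G a * rightMulMatrix x).trace =
      {h : G | h * x * h⁻¹ = x}.ncard * partialAug (ConjClasses.mk x) a := by
  classical
  have ha : leftRegularMatrix G a =
      ∑ g ∈ a.coeff.support, a.coeff g • leftRegularMatrix G (MonoidAlgebra.of ℤ G g) := by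
    simp only [leftRegularMatrix, MonoidAlgebra.lift_of]
    rw [MonoidAlgebra.lift_apply]
    rfl
  rw [ha, Finset.sum_mul, Matrix.trace_sum, partialAug, Finset.mul_sum, Finset.sum_filter]
  refine Finset.sum_congr rfl fun g _ => ?_
  rw [smul_mul_assoc, Matrix.trace_smul, trace_leftRegularMatrix_of_mul_rightMulMatrix,
    smul_eq_mul]
  split_ifs with hg
  · rw [ConjClasses.mem_carrier_iff_mk_eq, ConjClasses.mk_eq_mk_iff_isConj] at hg
    rw [ncard_conjugators_of_isConj hg.symm, mul_comm]
  · have : {h : G | h * x * h⁻¹ = g} = ∅ := by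
      rw [Set.eq_empty_iff_forall_notMem]
      intro h hh
      apply hg
      rw [ConjClasses.mem_carrier_iff_mk_eq, ConjClasses.mk_eq_mk_iff_isConj]
      exact (isConj_iff.2 ⟨h, hh⟩).symm
    simp [this]

/-- Let `C` be the diagonal indicator of a set of representatives for `G / ⟨z⟩`. Its conjugates by
the powers of `z` are the indicators of the translates, which partition `G`. The exponent `orderOf z
- j` stands for `-j`. -/
theorem exists_sum_rightMulMatrix_conj_eq_one (z : G) :
    ∃ C : Matrix G G ℤ, ∑ j ∈ Finset.range (orderOf z),
      rightMulMatrix z ^ j * C * rightMulMatrix z ^ (orderOf z - j) = 1 := by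
  let t : G → G := fun g => ((g : G ⧸ Subgroup.zpowers z)).out
  have ht : ∀ g : G, ∃ i < orderOf z, g * z ^ i = t g := by
    intro g
    have h1 : g⁻¹ * t g ∈ Subgroup.zpowers z :=
      QuotientGroup.eq.1 (Quotient.out_eq _).symm
    rw [mem_zpowers_iff_mem_range_orderOf] at h1
    obtain ⟨i, hi, h2⟩ := Finset.mem_image.1 h1
    exact ⟨i, Finset.mem_range.1 hi, by rw [h2, mul_inv_cancel_left]⟩
  have htz : ∀ g (j : ℕ), t (g * z ^ j) = t g := by
    intro g j
    have : ((g * z ^ j : G) : G ⧸ Subgroup.zpowers z) = g :=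
      QuotientGroup.mk_mul_of_mem g (pow_mem (Subgroup.mem_zpowers z) j)
    simp only [t, this]
  let D : G → ℤ := fun g => if t g = g then 1 else 0
  refine ⟨Matrix.diagonal D, ?_⟩
  have hcomm : ∀ j < orderOf z,
      rightMulMatrix z ^ j * Matrix.diagonal D * rightMulMatrix z ^ (orderOf z - j) =
        Matrix.diagonal fun g => D (g * z ^ j) := by
    intro j hj
    have h1 : rightMulMatrix z ^ j * Matrix.diagonal D =
        (Matrix.diagonal fun g => D (g * z ^ j)) * rightMulMatrix z ^ j := by
      ext g h
      rw [rightMulMatrix_pow, rightMulMatrix, PEquiv.toMatrix_toPEquiv_mul, Matrix.diagonal_mul,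
        Matrix.submatrix_apply, Equiv.coe_mulRight, id_eq, Matrix.diagonal_apply]
      simp [PEquiv.toMatrix_apply, eq_comm]
    rw [h1, mul_assoc, ← pow_add, Nat.add_sub_cancel' hj.le, rightMulMatrix_pow,
      pow_orderOf_eq_one, rightMulMatrix_one, mul_one]
  rw [Finset.sum_congr rfl fun j hj => hcomm j (Finset.mem_range.1 hj)]
  ext g h
  rw [Matrix.sum_apply]
  by_cases hgh : g = h
  · subst hgh
    simp only [Matrix.diagonal_apply_eq, Matrix.one_apply_eq, D, htz]
    obtain ⟨i, hi, hgi⟩ := ht g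
    rw [Finset.sum_eq_single i, if_pos hgi.symm]
    · intro j hj hji
      rw [if_neg]
      intro h1
      rw [← hgi] at h1
      exact hji (pow_injOn_Iio_orderOf (Finset.mem_range.1 hj) hi (mul_left_cancel h1).symm)
    · intro h1
      exact absurd (Finset.mem_range.2 hi) h1
  · simp [hgh]

end

/-- The partial augmentations of a torsion unit vanish at the classes of elements whose order does
not divide the order of the unit. -/
theorem partialAug_eq_zero [Finite G] {v : MonoidAlgebra ℤ G} {k : ℕ} (hk : k ≠ 0)
    (hv : v ^ k = 1) {C : ConjClasses G} (hC : ¬ classOrder C ∣ k) : partialAug C v = 0 := by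
  classical
  have := Fintype.ofFinite G
  obtain ⟨x, rfl⟩ := ConjClasses.exists_rep C
  change ¬ orderOf x ∣ k at hC
  obtain ⟨p, b, m, hp, hm, hkm, hom, hom'⟩ :=
    exists_prime_pow_mul_of_not_dvd (orderOf_pos x).ne' hk hC
  have : Fact p.Prime := ⟨hp⟩
  set A := leftRegularMatrix G v * rightMulMatrix x
  -- The two factors commute, and the powers of `v` disappear.
  have hA : ∀ j, k ∣ j → A ^ j = rightMulMatrix (x ^ j) := by
    rintro _ ⟨c, rfl⟩
    rw [(commute_leftRegularMatrix_rightMulMatrix v x).mul_pow, ← map_pow, pow_mul v, hv, one_pow,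
      map_one, one_mul, rightMulMatrix_pow]
  have hz : orderOf (x ^ (p ^ b * m)) = p := by
    apply orderOf_eq_prime
    · rw [← pow_mul, show p ^ b * m * p = p ^ (b + 1) * m by ring]
      exact orderOf_dvd_iff_pow_eq_one.1 hom
    · rwa [Ne, ← orderOf_dvd_iff_pow_eq_one]
  obtain ⟨C, hC⟩ := exists_sum_rightMulMatrix_conj_eq_one (x ^ (p ^ b * m))
  rw [hz] at hC
  have htr : A.trace = 0 := by
    apply Matrix.trace_eq_zero_of_relativelyProjective p A C b m hm
    · have hkm' : k ∣ p ^ (b + 1) * m :=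
        hkm.trans (mul_dvd_mul (pow_dvd_pow p (Nat.le_succ b)) dvd_rfl)
      rw [hA _ hkm', orderOf_dvd_iff_pow_eq_one.1 hom, rightMulMatrix_one]
    · rw [hA _ hkm]
      exact hC
  rw [trace_leftRegularMatrix_mul_rightMulMatrix] at htr
  refine (mul_eq_zero.1 htr).resolve_left ?_
  exact Nat.cast_ne_zero.2 ((Set.ncard_pos (Set.toFinite _)).2 ⟨1, by simp⟩).ne'

end GroupRingUnits

/-! ### Cyclotomic traces and sums over roots of unity -/

theorem IntermediateField.algebraMap_trace_adjoin_sum_zpow {F E : Type*} [Field F] [Field E]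
    [Algebra F E] [IsAlgClosed E] [DecidableEq E] {η : E} (hint : IsIntegral F η)
    (hsep : IsSeparable F η) {S : Type*} (s : Finset S) (r : S → ℕ) (e : S → ℤ)
    (y : IntermediateField.adjoin F {η}) (hy : (y : E) = ∑ j ∈ s, r j * η ^ e j) :
    algebraMap F E (Algebra.trace F (IntermediateField.adjoin F {η}) y) =
      ∑ x ∈ ((minpoly F η).aroots E).toFinset, ∑ j ∈ s, r j * x ^ e j := by
  have : FiniteDimensional F (IntermediateField.adjoin F {η}) :=
    IntermediateField.adjoin.finiteDimensional hint
  have : Algebra.IsSeparable F (IntermediateField.adjoin F {η}) :=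
    (IntermediateField.isSeparable_adjoin_simple_iff_isSeparable F E).2 hsep
  have hgen : y = ∑ j ∈ s, r j * IntermediateField.AdjoinSimple.gen F η ^ e j := by
    apply Subtype.val_injective
    rw [hy]
    push_cast
    rfl
  rw [trace_eq_sum_embeddings (K := F) (L := IntermediateField.adjoin F {η}) E (x := y),
    Finset.sum_subtype _ (p := fun x => x ∈ (minpoly F η).aroots E)
      (F := Fintype.ofEquiv _ (IntermediateField.algHomAdjoinIntegralEquiv F hint))
      (fun x => Multiset.mem_toFinset)]
  symm
  refine Finset.sum_bijective (IntermediateField.algHomAdjoinIntegralEquiv F (K := E) hint).symm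
    (Equiv.bijective _) (fun x => by simp only [Finset.mem_univ]) fun x _ => ?_
  rw [hgen, map_sum]
  refine Finset.sum_congr rfl fun j _ => ?_
  rw [map_mul, map_natCast, map_zpow₀,
    IntermediateField.algHomAdjoinIntegralEquiv_symm_apply_gen]

/-- Irreducibility of the cyclotomic polynomial makes all primitive `D`-th roots conjugate to `η`.
-/
theorem IsPrimitiveRoot.trace_adjoin_sum_zpow {η : ℂ} {D : ℕ} (hη : IsPrimitiveRoot η D)
    (hD : 0 < D) {S : Type*} (s : Finset S) (r : S → ℕ) (e : S → ℤ)
    (y : IntermediateField.adjoin ℚ {η}) (hy : (y : ℂ) = ∑ j ∈ s, r j * η ^ e j) :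
    ((Algebra.trace ℚ (IntermediateField.adjoin ℚ {η}) y : ℚ) : ℂ) =
      ∑ x ∈ primitiveRoots D ℂ, ∑ j ∈ s, r j * x ^ e j := by
  have hint : IsIntegral ℚ η := (hη.isIntegral hD).tower_top
  have : NeZero (D : ℂ) := ⟨Nat.cast_ne_zero.2 hD.ne'⟩
  have hroots : ((minpoly ℚ η).aroots ℂ).toFinset = primitiveRoots D ℂ := by
    ext x
    rw [Multiset.mem_toFinset, mem_primitiveRoots hD,
      ← Polynomial.cyclotomic_eq_minpoly_rat hη hD,
      Polynomial.mem_aroots', Polynomial.map_cyclotomic, ← Polynomial.isRoot_cyclotomic_iff,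
      Polynomial.IsRoot.def, Polynomial.aeval_def, Polynomial.eval₂_eq_eval_map,
      Polynomial.map_cyclotomic]
    exact ⟨fun hx => hx.2, fun hx => ⟨Polynomial.cyclotomic_ne_zero D ℂ, hx⟩⟩
  rw [← hroots]
  exact IntermediateField.algebraMap_trace_adjoin_sum_zpow hint
    (minpoly.irreducible hint).separable s r e y hy

theorem IsPrimitiveRoot.sum_range_pow_eq {K M : Type*} [Field K] [AddCommMonoid M] {ζ : K} {n : ℕ}
    (hζ : IsPrimitiveRoot ζ n) (hn : 0 < n) (g : K → M) :
    ∑ j ∈ Finset.range n, g (ζ ^ j) = ∑ x ∈ Polynomial.nthRootsFinset n (1 : K), g x := by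
  have : NeZero n := ⟨hn.ne'⟩
  refine Finset.sum_bij (fun j _ => ζ ^ j) ?_ ?_ ?_ fun _ _ => rfl
  · intro j _
    rw [Polynomial.mem_nthRootsFinset hn, ← pow_mul, mul_comm, pow_mul, hζ.pow_eq_one, one_pow]
  · intro j hj j' hj' h
    exact hζ.pow_inj (Finset.mem_range.1 hj) (Finset.mem_range.1 hj') h
  · intro x hx
    rw [Polynomial.mem_nthRootsFinset hn] at hx
    obtain ⟨j, hj, rfl⟩ := hζ.eq_pow_of_pow_eq_one hx
    exact ⟨j, Finset.mem_range.2 hj, rfl⟩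

theorem IsPrimitiveRoot.sum_nthRootsFinset_zpow {K : Type*} [Field K] [DecidableEq K] {ζ : K}
    {n : ℕ} (hζ : IsPrimitiveRoot ζ n) (hn : 0 < n) (e : ℤ) :
    ∑ x ∈ Polynomial.nthRootsFinset n (1 : K), x ^ e = if ζ ^ e = 1 then (n : K) else 0 := by
  rw [← hζ.sum_range_pow_eq hn]
  have h : ∀ j : ℕ, (ζ ^ j) ^ e = (ζ ^ e) ^ j := fun j => by
    rw [← zpow_natCast, ← zpow_natCast, ← zpow_mul, ← zpow_mul, mul_comm]
  simp only [h]
  split_ifs with h1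
  · simp [h1]
  · have h2 : (∑ j ∈ Finset.range n, (ζ ^ e) ^ j) * (ζ ^ e - 1) = 0 := by
      rw [geom_sum_mul, ← h, hζ.pow_eq_one, one_zpow, sub_self]
    exact (mul_eq_zero.1 h2).resolve_right (sub_ne_zero.2 h1)

theorem sum_divisors_sum_primitiveRoots {K M : Type*} [Field K] [AddCommMonoid M]
    (n : ℕ) (g : K → M) :
    ∑ d ∈ n.divisors, ∑ x ∈ primitiveRoots (n / d) K, g x =
      ∑ x ∈ Polynomial.nthRootsFinset n (1 : K), g x := by
  classical
  rw [Nat.sum_div_divisors n fun d => ∑ x ∈ primitiveRoots d K, g x,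
    IsPrimitiveRoot.nthRoots_one_eq_biUnion_primitiveRoots, Finset.sum_biUnion]
  exact fun a _ b _ hab => IsPrimitiveRoot.disjoint hab

/-! ### Character formula and multiplicities -/

namespace GroupRingUnits

variable {G : Type*} [Group G] {V : Type*} [AddCommGroup V] [Module ℂ V]

theorem trace_extend (ρ : Representation ℂ G V) (a : MonoidAlgebra ℤ G) [Fintype (ConjClasses G)] :
    LinearMap.trace ℂ V (extend ρ a) = ∑ C : ConjClasses G, partialAug C a * classChar ρ C := by
  classical
  have ha : extend ρ a = ∑ g ∈ a.coeff.support, a.coeff g • ρ g :=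
    MonoidAlgebra.lift_apply _ _
  rw [ha, map_sum, ← Finset.sum_fiberwise (g := ConjClasses.mk)]
  refine Finset.sum_congr rfl fun C _ => ?_
  rw [partialAug, Int.cast_sum, Finset.sum_mul]
  simp only [ConjClasses.mem_carrier_iff_mk_eq]
  refine Finset.sum_congr (by ext; simp) fun g hg => ?_
  rw [← (Finset.mem_filter.1 hg).2, classChar_mk, map_zsmul, zsmul_eq_mul]
  rfl

/-- The vanishing theorem discards all classes outside `Cl G k`. -/
theorem trace_extend_of_pow_eq_one [Finite G] (ρ : Representation ℂ G V) {a : MonoidAlgebra ℤ G} {k : ℕ}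
    (hk : k ≠ 0) (ha : a ^ k = 1) :
    LinearMap.trace ℂ V (extend ρ a) =
      ∑ C : Cl G k, partialAug (C : ConjClasses G) a * classChar ρ C := by
  classical
  have := Fintype.ofFinite (ConjClasses G)
  rw [trace_extend, Finset.sum_coe_sort (Cl G k) fun C => partialAug C a * classChar ρ C]
  refine (Finset.sum_subset (Finset.subset_univ _) fun C _ hC => ?_).symm
  rw [mem_Cl] at hC
  rw [partialAug_eq_zero hk ha hC, Int.cast_zero, zero_mul]

end GroupRingUnits

theorem mainTheorem6 {G : Type*} [Group G] [Finite G]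
    {V : Type*} [AddCommGroup V] [Module ℂ V] [FiniteDimensional ℂ V]
    (ρ : Representation ℂ G V)
    (n : ℕ) (hn : 0 < n) (u : (MonoidAlgebra ℤ G)ˣ) (hu : u ^ n = 1)
    (ζ : ℂ) (hζ : IsPrimitiveRoot ζ n) (i : ℤ) :
    ∃ μ : ℕ,
      (1 / (n : ℚ)) * ∑ d : n.divisors, ∑ C : GroupRingUnits.Cl G (n / (d : ℕ)),
          (GroupRingUnits.partialAug (C : ConjClasses G)
              ((u : MonoidAlgebra ℤ G) ^ (d : ℕ)) : ℚ) *
            Algebra.trace ℚ (IntermediateField.adjoin ℚ {ζ ^ (d : ℕ)})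
              ⟨GroupRingUnits.classChar ρ (C : ConjClasses G) * ζ ^ (-(i * ((d : ℕ) : ℤ))),
                GroupRingUnits.classChar_mul_mem hζ ρ i d C⟩ = (μ : ℚ) ∧
      (GroupRingUnits.extend ρ (u : MonoidAlgebra ℤ G)).charpoly.rootMultiplicity (ζ ^ i) = μ ∧
      Module.finrank ℂ
        (Module.End.eigenspace (GroupRingUnits.extend ρ (u : MonoidAlgebra ℤ G)) (ζ ^ i)) = μ := by
  classical
  have hu' : (u : MonoidAlgebra ℤ G) ^ n = 1 := by
    rw [← Units.val_pow_eq_pow_val, hu, Units.val_one]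
  set U := GroupRingUnits.extend ρ (u : MonoidAlgebra ℤ G) with hUdef
  have hU : U ^ n = 1 := by rw [hUdef, ← map_pow, hu', map_one]
  have hnC : (n : ℂ) ≠ 0 := Nat.cast_ne_zero.2 hn.ne'
  have hζ0 : ζ ≠ 0 := hζ.ne_zero hn.ne'
  refine ⟨Module.finrank ℂ (U.eigenspace (ζ ^ i)), ?_,
    Module.End.rootMultiplicity_charpoly_of_pow_eq_one hnC hU _, rfl⟩
  let F : ℂ → ℂ := fun x => ∑ j ∈ Finset.range n,
    Module.finrank ℂ (U.eigenspace (ζ ^ j)) * x ^ ((j : ℤ) - i)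
  have hd : ∀ d : n.divisors, ((∑ C : GroupRingUnits.Cl G (n / (d : ℕ)),
      (GroupRingUnits.partialAug (C : ConjClasses G) ((u : MonoidAlgebra ℤ G) ^ (d : ℕ)) : ℚ) *
        Algebra.trace ℚ (IntermediateField.adjoin ℚ {ζ ^ (d : ℕ)})
          ⟨GroupRingUnits.classChar ρ (C : ConjClasses G) * ζ ^ (-(i * ((d : ℕ) : ℤ))),
            GroupRingUnits.classChar_mul_mem hζ ρ i d C⟩ : ℚ) : ℂ) =
      ∑ x ∈ primitiveRoots (n / (d : ℕ)) ℂ, F x := by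
    intro d
    have hdn : (d : ℕ) ∣ n := Nat.dvd_of_mem_divisors d.2
    have hD : 0 < n / (d : ℕ) := Nat.div_pos (Nat.le_of_dvd hn hdn) (Nat.pos_of_mem_divisors d.2)
    have hη : IsPrimitiveRoot (ζ ^ (d : ℕ)) (n / d) := hζ.pow hn (Nat.mul_div_cancel' hdn).symm
    -- By linearity the sum over `C` is a single field trace, whose argument is then recognized as
    -- `tr(U^d) ζ^(-id)`.
    simp only [← smul_eq_mul (α := ℚ), ← map_smul, ← map_sum]
    apply hη.trace_adjoin_sum_zpow hD
    have hpow : ((u : MonoidAlgebra ℤ G) ^ (d : ℕ)) ^ (n / (d : ℕ)) = 1 := by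
      rw [← pow_mul, Nat.mul_div_cancel' hdn, hu']
    have htr := GroupRingUnits.trace_extend_of_pow_eq_one ρ hD.ne' hpow
    rw [map_pow, ← hUdef, Module.End.trace_pow_eq_sum_finrank_eigenspace hnC hU,
      ← hζ.sum_range_pow_eq hn fun a => (Module.finrank ℂ (U.eigenspace a) : ℂ) * a ^ (d : ℕ)]
      at htr
    have hval : ((∑ C : GroupRingUnits.Cl G (n / (d : ℕ)),
        (GroupRingUnits.partialAug (C : ConjClasses G)
          ((u : MonoidAlgebra ℤ G) ^ (d : ℕ)) : ℚ) •
          (⟨GroupRingUnits.classChar ρ (C : ConjClasses G) * ζ ^ (-(i * ((d : ℕ) : ℤ))),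
            GroupRingUnits.classChar_mul_mem hζ ρ i d C⟩ :
              IntermediateField.adjoin ℚ {ζ ^ (d : ℕ)}) :
            IntermediateField.adjoin ℚ {ζ ^ (d : ℕ)}) : ℂ) =
        (∑ C : GroupRingUnits.Cl G (n / (d : ℕ)),
          (GroupRingUnits.partialAug (C : ConjClasses G) ((u : MonoidAlgebra ℤ G) ^ (d : ℕ)) : ℂ) *
            GroupRingUnits.classChar ρ C) * ζ ^ (-(i * ((d : ℕ) : ℤ))) := by
      rw [Finset.sum_mul, AddSubmonoidClass.coe_finsetSum]
      refine Finset.sum_congr rfl fun C _ => ?_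
      rw [IntermediateField.coe_smul, Algebra.smul_def, eq_ratCast, Rat.cast_intCast, mul_assoc]
    rw [hval, ← htr, Finset.sum_mul]
    refine Finset.sum_congr rfl fun j _ => ?_
    rw [mul_assoc, ← zpow_natCast, ← zpow_natCast, ← zpow_natCast, ← zpow_mul, ← zpow_mul,
      ← zpow_add₀ hζ0]
    congr 2
    ring
  -- Orthogonality: the sum of `x^(j-i)` over the `n`-th roots of unity vanishes unless `ζ^j = ζ^i`.
  have htotal : ∑ x ∈ Polynomial.nthRootsFinset n (1 : ℂ), F x =
      n * Module.finrank ℂ (U.eigenspace (ζ ^ i)) := by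
    simp only [F]
    rw [Finset.sum_comm]
    simp only [← Finset.mul_sum, hζ.sum_nthRootsFinset_zpow hn, zpow_sub₀ hζ0,
      div_eq_one_iff_eq (zpow_ne_zero i hζ0), zpow_natCast]
    rw [hζ.sum_range_pow_eq hn fun a =>
      (Module.finrank ℂ (U.eigenspace a) : ℂ) * if a = ζ ^ i then (n : ℂ) else 0]
    have hmem : ζ ^ i ∈ Polynomial.nthRootsFinset n (1 : ℂ) := by
      rw [Polynomial.mem_nthRootsFinset hn, ← zpow_natCast, ← zpow_mul, mul_comm, zpow_mul,
        zpow_natCast, hζ.pow_eq_one, one_zpow]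
    simp only [mul_ite, mul_zero, Finset.sum_ite_eq', hmem, if_true]
    exact mul_comm _ _
  apply Rat.cast_injective (α := ℂ)
  rw [Rat.cast_mul, Rat.cast_sum, Finset.sum_congr rfl fun d _ => hd d,
    Finset.sum_coe_sort n.divisors fun d => ∑ x ∈ primitiveRoots (n / d) ℂ, F x,
    sum_divisors_sum_primitiveRoots, htotal]
  push_cast
  field_simp
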